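/- Let $Q\ge 1$ be an integer and $K>1$ a real number. Let $\mathbf{Q}_Q(\mathbb{R})$ be the set of unordered $Q$-tuples $\sum_{i=1}^Q[[p_i]]$ of real numbers, with the metric $\mathcal{G}\big(\sum_i[[p_i]],\sum_i[[q_i]]\big)=\min_\sigma\big(\sum_i|p_i-q_{\sigma(i)}|^2\big)^{1/2}$ over all permutations $\sigma$, and let $\xi:\mathbf{Q}_Q(\mathbb{R})\to\mathbb{R}^Q$ send a tuple to its nondecreasing rearrangement. For an open interval $U\subset\mathbb{R}$ (possibly $U=\mathbb{R}$), $\mathcal{Y}_2(U,\mathbf{Q}_Q(\mathbb{R}))$ is the set of $u:U\to\mathbf{Q}_Q(\mathbb{R})$ with $\xi\circ u\in W^{1,2}(U,\mathbb{R}^Q)$, maps that agree a.e. being identified; $u$ is strictly defined if $\xi(u(x))=y$ whenever $x\in U$, $y\in\mathbb{R}^Q$ and $r^{-1}\int_{x-r}^{x+r}|\xi(u(z))-y|\,dz\to0$ as $r\to 0^+$. If there are affine functions $v_1,\dots,v_Q:\mathbb{R}\to\mathbb{R}$ such that $\mathcal{G}\big(u(z),\sum_i[[v_i(z)]]\big)/|z-x|$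 has approximate limit $0$ as $z\to x$, put $|\mathrm{ap}Au(x)|^2=\sum_i|v_i'|^2$; for $u\in\mathcal{Y}_2(U,\mathbf{Q}_Q(\mathbb{R}))$ this is the case for a.e. $x\in U$, and $\mathrm{Dir}(u,U)=\int_U|\mathrm{ap}Au(x)|^2\,dx$. For a bounded open interval $U$ and $g:\partial U\to\mathbf{Q}_Q(\mathbb{R})$, a map $u$ has boundary values $g$ on $\partial U$ if there is a strictly defined $w\in\mathcal{Y}_2(\mathbb{R},\mathbf{Q}_Q(\mathbb{R}))$ with $w=u$ a.e. on $U$ and $w=g$ on $\partial U$. A map $v\in\mathcal{Y}_2(U,\mathbf{Q}_Q(\mathbb{R}))$ with boundary values $g$ is Dirichlet minimizing if $\mathrm{Dir}(v,U)$ is the infimum of $\mathrm{Dir}(w,U)$ over all $w\in\mathcal{Y}_2(U,\mathbf{Q}_Q(\mathbb{R}))$ with boundary values $g$. A strictly defined $u\in\mathcal{Y}_2((-1,1),\mathbf{Q}_Q(\mathbb{R}))$ is a Dirichlet $K$-quasiminimizer if for every interval $(a,b)$ with $-1\le a<b\le 1$ one has $\mathrm{Dir}(u,(a,b))\le K\,\mathrm{Dir}(v,(a,b))$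 whenever $v$ is Dirichlet minimizing on $(a,b)$ with the boundary values of $u$ on $\partial(a,b)$. **Theorem.** Let $u\in\mathcal{Y}_2((-1,1),\mathbf{Q}_Q(\mathbb{R}))$ be strictly defined. The following are equivalent: 1. $u$ is a Dirichlet $K$-quasiminimizer; 2. for all $-1<a<b<1$, $$\mathrm{Dir}(u,(a,b))\le K\,\frac{\mathcal{G}^2(u(b),u(a))}{b-a};$$ 3. for all $-1\le a<b\le 1$, $u$ has boundary values $g$ on $\partial(a,b)$, for some $g:\{a,b\}\to\mathbf{Q}_Q(\mathbb{R})$ with $$\mathrm{Dir}(u,(a,b))\le K\,\frac{\mathcal{G}^2(g(b),g(a))}{b-a}.$$ -/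

import Mathlib

open Set Filter Topology MeasureTheory
open scoped ENNReal ContDiff

noncomputable section

namespace MultiValued

/-- The point `∑ i, [[p i]]` of `𝐐_Q(ℝ)`. The space `𝐐_Q(ℝ)` of unordered `Q`-tuples of reals
(sums of `Q` Dirac masses) is `Sym ℝ Q`, the type of multisets of cardinality `Q`. -/
def ofTuple {Q : ℕ} (p : Fin Q → ℝ) : Sym ℝ Q :=
  ⟨Finset.univ.val.map p, by simp⟩

/-- The nondecreasing enumeration `p₁ ≤ ⋯ ≤ p_Q` of `∑ i, [[p i]]`. -/
def sorted {Q : ℕ} (s : Sym ℝ Q) (i : Fin Q) : ℝ :=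
  (s.1.sort (· ≤ ·)).get (i.cast (by rw [Multiset.length_sort, s.2]))

theorem ofTuple_sorted {Q : ℕ} (s : Sym ℝ Q) : ofTuple (sorted s) = s := by
  have hlen : (s.1.sort (· ≤ ·)).length = Q := by rw [Multiset.length_sort, s.2]
  apply Subtype.ext
  have h : List.ofFn (sorted s) = s.1.sort (· ≤ ·) := by
    apply List.ext_get
    · rw [hlen, List.length_ofFn]
    · intro n h1 h2
      simp only [sorted, List.get_ofFn]
      rfl
  have h2 : (Finset.univ.val.map (sorted s) : Multiset ℝ) = (List.ofFn (sorted s) : Multiset ℝ) := by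
    rw [Fin.univ_val_map]
  change (Finset.univ.val.map (sorted s) : Multiset ℝ) = s.1
  rw [h2, h, Multiset.sort_eq]

/-- The metric `𝒢(s, t) = min_σ (∑ i, |s_i - t_{σ i}|²)^{1/2}`, `σ` running through all permutations.
By `dist𝒢_ofTuple` the enumerations used do not matter. -/
def dist𝒢 {Q : ℕ} (s t : Sym ℝ Q) : ℝ :=
  Finset.univ.inf' Finset.univ_nonempty
    fun σ : Equiv.Perm (Fin Q) => √(∑ i, |sorted s i - sorted t (σ i)| ^ 2)

theorem exists_perm_of_ofTuple_eq {Q : ℕ} {p q : Fin Q → ℝ} (h : ofTuple p = ofTuple q) :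
    ∃ π : Equiv.Perm (Fin Q), ∀ i, p i = q (π i) := by
  have h1 : (List.ofFn p : Multiset ℝ) = (List.ofFn q : Multiset ℝ) := by
    rw [← Fin.univ_val_map, ← Fin.univ_val_map]
    exact congrArg Subtype.val h
  have h2 : p ∘ Tuple.sort p = q ∘ Tuple.sort q := List.ofFn_injective <|
    ((((Tuple.sort p).ofFn_comp_perm p).trans (Multiset.coe_eq_coe.1 h1)).trans
      ((Tuple.sort q).ofFn_comp_perm q).symm).eq_of_pairwise' (r := (· ≤ ·))
      (Tuple.monotone_sort p).sortedLE_ofFn.pairwise (Tuple.monotone_sort q).sortedLE_ofFn.pairwise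
  refine ⟨(Tuple.sort p).symm.trans (Tuple.sort q), fun i => ?_⟩
  simpa using congrFun h2 ((Tuple.sort p).symm i)

theorem dist𝒢_ofTuple {Q : ℕ} (p q : Fin Q → ℝ) :
    dist𝒢 (ofTuple p) (ofTuple q) = Finset.univ.inf' Finset.univ_nonempty
      fun σ : Equiv.Perm (Fin Q) => √(∑ i, |p i - q (σ i)| ^ 2) := by
  obtain ⟨α, hα⟩ := exists_perm_of_ofTuple_eq (ofTuple_sorted (ofTuple p))
  obtain ⟨β, hβ⟩ := exists_perm_of_ofTuple_eq (ofTuple_sorted (ofTuple q))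
  have key : ∀ σ : Equiv.Perm (Fin Q),
      √(∑ i, |sorted (ofTuple p) i - sorted (ofTuple q) (σ i)| ^ 2) =
        √(∑ i, |p i - q ((α.symm.trans (σ.trans β)) i)| ^ 2) := by
    intro σ
    congr 1
    rw [← Equiv.sum_comp α (fun i => |p i - q ((α.symm.trans (σ.trans β)) i)| ^ 2)]
    simp [hα, hβ]
  apply le_antisymm
  · refine Finset.le_inf' _ _ fun σ _ => ?_
    refine (Finset.inf'_le _ (Finset.mem_univ (α.trans (σ.trans β.symm)))).trans (le_of_eq ?_)
    rw [key]
    simp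
  · refine Finset.le_inf' _ _ fun σ _ => ?_
    rw [key]
    exact Finset.inf'_le _ (Finset.mem_univ _)

/-- The bi-Lipschitz embedding `ξ : 𝐐_Q(ℝ) → ℝ^Q`; for real-valued tuples it is the sorting map
(one projection direction, `P = 1`). -/
def ξ {Q : ℕ} (s : Sym ℝ Q) : EuclideanSpace ℝ (Fin Q) :=
  WithLp.toLp 2 (sorted s)

/-! ### Sobolev spaces -/

/-- `g` is the distributional derivative of `f` on the open set `U ⊆ ℝ`. -/
def IsWeakDeriv {E : Type*} [NormedAddCommGroup E] [NormedSpace ℝ E]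
    (U : Set ℝ) (f g : ℝ → E) : Prop :=
  ∀ φ : ℝ → ℝ, ContDiff ℝ ∞ φ → HasCompactSupport φ → tsupport φ ⊆ U →
    ∫ x in U, deriv φ x • f x = -∫ x in U, φ x • g x

/-- `f ∈ W^{1,2}(U, E)`. Only the values of `f` on `U` matter. -/
def MemW12 {E : Type*} [NormedAddCommGroup E] [NormedSpace ℝ E]
    (U : Set ℝ) (f : ℝ → E) : Prop :=
  MemLp f 2 (volume.restrict U) ∧
    ∃ g : ℝ → E, MemLp g 2 (volume.restrict U) ∧ IsWeakDeriv U f g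

/-- `f` is strictly defined on the open set `U`: `f x = y` whenever `x ∈ U` and
`r⁻¹ ∫_{B(x,r)} |f - y| → 0` as `r → 0`. -/
def IsStrictlyDefined {E : Type*} [NormedAddCommGroup E] (U : Set ℝ) (f : ℝ → E) : Prop :=
  ∀ x ∈ U, ∀ y : E,
    Tendsto (fun r : ℝ => (∫⁻ z in Metric.closedBall x r, ‖f z - y‖ₑ) / ENNReal.ofReal r)
      (𝓝[>] 0) (𝓝 0) → f x = y

/-- `u ∈ 𝒴₂(U, 𝐐_Q(ℝ))`, for `U` an open interval or `ℝ`. Only the values of `u` on `U` matter. -/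
def MemY2 {Q : ℕ} (U : Set ℝ) (u : ℝ → Sym ℝ Q) : Prop :=
  MemW12 U fun x => ξ (u x)

/-- `u` is strictly defined on `U`. -/
def StrictlyDefined {Q : ℕ} (U : Set ℝ) (u : ℝ → Sym ℝ Q) : Prop :=
  IsStrictlyDefined U fun x => ξ (u x)

/-! ### Approximate affine approximation and the Dirichlet integral -/

/-- `ap lim_{x → a} f x = l`: for every `ε > 0` the set where `|f - l| ≥ ε` has density `0`
at `a`. -/
def HasApLim (f : ℝ → ℝ) (a l : ℝ) : Prop :=
  ∀ ε > 0, Tendsto (fun r : ℝ => volume (Metric.closedBall a r ∩ {x | ε ≤ |f x - l|}) /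
    volume (Metric.closedBall a r)) (𝓝[>] 0) (𝓝 0)

/-- `u` is approximately affinely approximable at `a`, by `∑ i, [[v i]]` with affine `v i`. -/
def HasApAffine {Q : ℕ} (u : ℝ → Sym ℝ Q) (a : ℝ) (v : Fin Q → (ℝ →ᵃ[ℝ] ℝ)) : Prop :=
  HasApLim (fun x => dist𝒢 (u x) (ofTuple fun i => v i x) / |x - a|) a 0

open Classical in
/-- `|ap A u(a)|² = ∑ i, |v_i'|²`, where `ap A u(a) = ∑ i, [[v i]]`. The value `0` at points where
`u` is not approximately affinely approximable is immaterial: for `u ∈ 𝒴₂` these form a null set. -/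
def apNormSq {Q : ℕ} (u : ℝ → Sym ℝ Q) (a : ℝ) : ℝ≥0∞ :=
  if h : ∃ v, HasApAffine u a v then ENNReal.ofReal (∑ i, |(h.choose i).linear 1| ^ 2) else 0

/-- The Dirichlet integral `Dir(u; U) = ∫_U |ap A u|²`. -/
def Dir {Q : ℕ} (u : ℝ → Sym ℝ Q) (U : Set ℝ) : ℝ≥0∞ :=
  ∫⁻ x in U, apNormSq u x

/-! ### Boundary values, minimizers and quasiminimizers -/

/-- `u` has boundary values `g` on `∂U`: some strictly defined `w ∈ 𝒴₂(ℝ, 𝐐_Q(ℝ))` agrees with `u`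
in `𝒴₂(U, 𝐐_Q(ℝ))` (almost everywhere on `U`) and with `g` on `∂U`
(`ℋ⁰`-almost everywhere, that is, everywhere). Only the values of `g` on `∂U` matter. -/
def HasBoundaryValues {Q : ℕ} (U : Set ℝ) (u g : ℝ → Sym ℝ Q) : Prop :=
  ∃ w : ℝ → Sym ℝ Q, MemY2 univ w ∧ StrictlyDefined univ w ∧
    (∀ᵐ x ∂volume.restrict U, w x = u x) ∧ ∀ x ∈ frontier U, w x = g x

/-- `v` is Dirichlet minimizing on `U` with boundary values `g`. -/
def IsDirMinimizing {Q : ℕ} (U : Set ℝ) (g v : ℝ → Sym ℝ Q) : Prop :=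
  MemY2 U v ∧ HasBoundaryValues U v g ∧
    Dir v U = sInf {d | ∃ w : ℝ → Sym ℝ Q, MemY2 U w ∧ HasBoundaryValues U w g ∧ d = Dir w U}

/-- `u` is a Dirichlet `K`-quasiminimizer on `(-1, 1)`. The balls of `ℝ` contained in `(-1, 1)` are
the intervals `(a, b)` with `-1 ≤ a < b ≤ 1`; `g` stands for `u|_{∂(a, b)}`. -/
def IsQuasiminimizer {Q : ℕ} (K : ℝ) (u : ℝ → Sym ℝ Q) : Prop :=
  MemY2 (Ioo (-1) 1) u ∧ StrictlyDefined (Ioo (-1) 1) u ∧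
    ∀ a b : ℝ, -1 ≤ a → a < b → b ≤ 1 →
      ∀ g v : ℝ → Sym ℝ Q, HasBoundaryValues (Ioo a b) u g → IsDirMinimizing (Ioo a b) g v →
        Dir u (Ioo a b) ≤ ENNReal.ofReal K * Dir v (Ioo a b)

end MultiValued

end

/-! By the rearrangement inequality, sorting `ξ` is an isometry from `𝐐_Q(ℝ)` onto the closed convex
cone of nondecreasing vectors in `ℝ^Q` (`dist𝒢_eq_norm`). A map in `𝒴₂` on a bounded interval thus
becomes a path `F` in this cone, a primitive of some `g ∈ L²` (`MemW12.exists_isPrimitive`). At a.e.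
point the slopes of the affine approximation are the entries of `g`, up to order, so the Dirichlet
integral is `∫ ‖g‖²` (`Dir_eq_lintegral`).

Cauchy–Schwarz bounds this energy below by `‖F b - F a‖² / (b - a)` (`HasBoundaryValues.le_Dir`).
The segment from `F a` to `F b` attains the bound and stays in the cone by convexity, so the minimal
energy is exactly `𝒢² / (b - a)` (`exists_isDirMinimizing`).

Boundary values are exactly the endpoint values of `F` (`hasBoundaryValues_iff`). Comparison with
the segment gives 1 ⇒ 2, continuity of `F` and of the energy up to `±1` gives 2 ⇒ 3, and the lower
bound applied to a minimizer gives 3 ⇒ 1. -/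

noncomputable section

namespace MultiValued

/-! ### Primitives and one-dimensional Sobolev functions -/

section Primitive

theorem _root_.MeasureTheory.LocallyIntegrable.intervalIntegrable' {E : Type*} [NormedAddCommGroup E]
    {g : ℝ → E}
    (hg : LocallyIntegrable g) (x y : ℝ) : IntervalIntegrable g volume x y :=
  intervalIntegrable_iff.mpr <|
    (hg.integrableOn_isCompact isCompact_uIcc).mono_set uIoc_subset_uIcc

variable {E : Type*} [NormedAddCommGroup E] [NormedSpace ℝ E]

/-- `F` is a primitive of the locally integrable function `g` on `ℝ`. -/
def IsPrimitive (F g : ℝ → E) : Prop :=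
  LocallyIntegrable g ∧ ∀ x y, F y - F x = ∫ t in x..y, g t

theorem isPrimitive_integral {g : ℝ → E} (hg : LocallyIntegrable g) (c : E) (a : ℝ) :
    IsPrimitive (fun x => c + ∫ t in a..x, g t) g :=
  ⟨hg, fun x y => by
    rw [add_sub_add_left_eq_sub, intervalIntegral.integral_interval_sub_left] <;>
      exact hg.intervalIntegrable' _ _⟩

namespace IsPrimitive

variable {F g : ℝ → E}

theorem eq_add (hF : IsPrimitive F g) (a : ℝ) : F = fun x => F a + ∫ t in a..x, g t := by
  funext x
  rw [← hF.2 a x]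
  abel

theorem continuous (hF : IsPrimitive F g) : Continuous F := by
  rw [hF.eq_add 0]
  exact continuous_const.add
    (intervalIntegral.continuous_primitive (fun a b => hF.1.intervalIntegrable' a b) 0)

theorem ae_hasDerivAt [CompleteSpace E] (hF : IsPrimitive F g) :
    ∀ᵐ x, HasDerivAt F (g x) x := by
  filter_upwards [LocallyIntegrable.ae_hasDerivAt_integral hF.1] with x hx
  rw [hF.eq_add 0]
  exact (hx 0).const_add _

theorem clm_comp [CompleteSpace E] (hF : IsPrimitive F g) (l : E →L[ℝ] ℝ) :
    IsPrimitive (fun x => l (F x)) (fun x => l (g x)) := by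
  have hl : LocallyIntegrable (fun x => l (g x)) := fun x => by
    obtain ⟨s, hs, h⟩ := hF.1 x
    exact ⟨s, hs, l.integrable_comp h⟩
  refine ⟨hl, fun x y => ?_⟩
  rw [l.intervalIntegral_comp_comm (hF.1.intervalIntegrable' x y), ← hF.2 x y, map_sub]

theorem absolutelyContinuousOnInterval {F g : ℝ → ℝ} (hF : IsPrimitive F g) (a b : ℝ) :
    AbsolutelyContinuousOnInterval F a b := by
  have h := (hF.1.intervalIntegrable'
    a b).absolutelyContinuousOnInterval_intervalIntegral (c := a) left_mem_uIcc
  have h2 : AbsolutelyContinuousOnInterval (fun _ : ℝ => F a) a b :=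
    (LipschitzWith.const (F a)).lipschitzOnWith.absolutelyContinuousOnInterval
  rw [hF.eq_add a]
  exact h2.add h

theorem integral_deriv_mul {F g : ℝ → ℝ} (hF : IsPrimitive F g) {φ : ℝ → ℝ}
    (hφ : ContDiff ℝ ∞ φ) {a b : ℝ} (ha : φ a = 0) (hb : φ b = 0) :
    ∫ x in a..b, deriv φ x * F x = -∫ x in a..b, φ x * g x := by
  have h1 : AbsolutelyContinuousOnInterval φ a b :=
    (hφ.of_le (by exact_mod_cast le_top)).contDiffOn.absolutelyContinuousOnInterval
  have h := h1.integral_mul_deriv_eq_deriv_mul (hF.absolutelyContinuousOnInterval a b)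
  rw [ha, hb] at h
  have h2 : ∫ x in a..b, φ x * g x = ∫ x in a..b, φ x * deriv F x := by
    apply intervalIntegral.integral_congr_ae
    filter_upwards [hF.ae_hasDerivAt] with x hx _
    rw [hx.deriv]
  rw [h2, h]
  ring

end IsPrimitive

/-- A test function supported in `U` only sees integrals over `U`. -/
theorem setIntegral_smul_of_tsupport_subset {U : Set ℝ} {φ : ℝ → ℝ} (h : tsupport φ ⊆ U)
    (f : ℝ → E) : ∫ x in U, φ x • f x = ∫ x, φ x • f x :=
  setIntegral_eq_integral_of_forall_compl_eq_zero fun x hx => by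
    rw [image_eq_zero_of_notMem_tsupport fun h' => hx (h h'), zero_smul]

theorem IsPrimitive.isWeakDeriv [CompleteSpace E] {F g : ℝ → E} (hF : IsPrimitive F g)
    (U : Set ℝ) : IsWeakDeriv U F g := by
  intro φ hφ hc hU
  have hcd : Continuous (deriv φ) := hφ.continuous_deriv (by simp)
  rw [setIntegral_smul_of_tsupport_subset hU,
    setIntegral_smul_of_tsupport_subset (Subset.trans tsupport_deriv_subset hU)]
  have hi1 : Integrable fun x => deriv φ x • F x :=
    (hcd.smul hF.continuous).integrable_of_hasCompactSupport hc.deriv.smul_right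
  have hi2 : Integrable fun x => φ x • g x :=
    hF.1.integrable_smul_left_of_hasCompactSupport hφ.continuous hc
  rw [← sub_eq_zero, sub_neg_eq_add]
  -- Continuous functionals separate points, so scalar integration by parts for absolutely
  -- continuous functions suffices.
  refine SeparatingDual.eq_zero_of_forall_dual_eq_zero (R := ℝ) fun l => ?_
  rw [map_add, ← l.integral_comp_comm hi1, ← l.integral_comp_comm hi2]
  simp only [map_smul, smul_eq_mul]
  obtain ⟨R, hR⟩ := hc.isBounded.subset_closedBall 0
  have hz : ∀ x, R < |x| → φ x = 0 := fun x hx =>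
    image_eq_zero_of_notMem_tsupport fun h' => by
      have := hR h'
      rw [mem_closedBall_zero_iff, Real.norm_eq_abs] at this
      linarith
  -- The endpoints `±(|R| + 1)` lie strictly outside the support of `φ`, so the boundary terms
  -- vanish; `|R|` covers a possibly negative `R`.
  have hsub : ∀ f : ℝ → ℝ, tsupport f ⊆ tsupport φ → ∀ h : ℝ → ℝ,
      ∫ x, f x * h x = ∫ x in -(|R| + 1)..(|R| + 1), f x * h x := by
    intro f hf h
    refine (intervalIntegral.integral_eq_integral_of_support_subset fun x hx => ?_).symm
    have hx' : x ∈ tsupport f := by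
      by_contra hx'
      exact hx (by simp [image_eq_zero_of_notMem_tsupport hx'])
    have := hR (hf hx')
    rw [mem_closedBall_zero_iff, Real.norm_eq_abs] at this
    have h1 := abs_le.1 (this.trans (le_abs_self R))
    exact ⟨by linarith, by linarith⟩
  rw [hsub _ tsupport_deriv_subset, hsub _ le_rfl,
    (hF.clm_comp l).integral_deriv_mul hφ (hz _ _) (hz _ _), neg_add_cancel]
  · rw [abs_neg, abs_of_nonneg (by positivity)]; linarith [le_abs_self R]
  · rw [abs_of_nonneg (by positivity)]; linarith [le_abs_self R]

theorem _root_.MeasureTheory.Integrable.continuous_smul_of_hasCompactSupport {μ : Measure ℝ}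
    {f : ℝ → E} (hf : Integrable f μ) {ψ : ℝ → ℝ} (hψ : Continuous ψ)
    (hc : HasCompactSupport ψ) : Integrable (fun x => ψ x • f x) μ := by
  obtain ⟨C, hC⟩ := hc.exists_bound_of_continuous hψ
  exact Integrable.bdd_smul hf C hψ.aestronglyMeasurable (ae_of_all _ hC)

/-- A function with vanishing distributional derivative on an interval is constant. -/
theorem IsWeakDeriv.ae_eq_const [CompleteSpace E] {a b : ℝ} (hab : a < b) {h : ℝ → E}
    (hh : IntegrableOn h (Ioo a b)) (hw : IsWeakDeriv (Ioo a b) h fun _ => 0) :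
    ∃ c, ∀ᵐ x ∂volume.restrict (Ioo a b), h x = c := by
  -- Outer radius `(b - a) / 4` keeps the closed support inside the open interval. The constant will
  -- be the average of `h` against this bump.
  let B : ContDiffBump ((a + b) / 2) :=
    ⟨(b - a) / 8, (b - a) / 4, by linarith, by linarith⟩
  let η : ℝ → ℝ := B.normed volume
  have hη : ContDiff ℝ ∞ η := B.contDiff_normed
  have hηc : HasCompactSupport η := B.hasCompactSupport_normed
  have hηs : tsupport η ⊆ Ioo a b := by
    rw [B.tsupport_normed_eq, Real.closedBall_eq_Icc]
    intro x hx
    have h1 := hx.1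
    have h2 := hx.2
    simp only [B] at h1 h2
    constructor <;> linarith
  have hη1 : ∫ x, η x = 1 := B.integral_normed
  set c := ∫ x in Ioo a b, η x • h x with hcdef
  refine ⟨c, ?_⟩
  have hloc : LocallyIntegrableOn (fun x => h x - c) (Ioo a b) :=
    (hh.sub (integrableOn_const (by simp))).locallyIntegrableOn
  have key := isOpen_Ioo.ae_eq_zero_of_integral_contDiff_smul_eq_zero hloc ?_
  · rw [ae_restrict_iff' measurableSet_Ioo]
    filter_upwards [key] with x hx hx'
    exact sub_eq_zero.1 (hx hx')
  intro ψ hψ hψc hψs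
  rw [← setIntegral_smul_of_tsupport_subset hψs]
  set m := ∫ x, ψ x with hm
  -- Subtracting `m * η` makes the integral zero, so the primitive of `θ` is again a test function.
  -- Testing `h` with it gives `∫ θ h = 0`, that is, `∫ ψ h = m c`.
  let θ : ℝ → ℝ := fun x => ψ x - m * η x
  have hθ : ContDiff ℝ ∞ θ := hψ.sub (contDiff_const.mul hη)
  have hψi : Integrable ψ := hψ.continuous.integrable_of_hasCompactSupport hψc
  have hηi : Integrable η := hη.continuous.integrable_of_hasCompactSupport hηc
  have hθ0 : ∫ x, θ x = 0 := by
    simp only [θ]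
    rw [integral_sub hψi (hηi.const_mul m), integral_const_mul, hη1, ← hm]
    ring
  obtain ⟨a', b', ha', hb', hs⟩ : ∃ a' b', a < a' ∧ b' < b ∧ ∀ x, x ∉ Icc a' b' → θ x = 0 := by
    have hK : IsCompact (tsupport ψ ∪ tsupport η) := hψc.isCompact.union hηc.isCompact
    have hKs : tsupport ψ ∪ tsupport η ⊆ Ioo a b := union_subset hψs hηs
    have hne : (tsupport ψ ∪ tsupport η).Nonempty := by
      rw [B.tsupport_normed_eq]
      exact ⟨_, Or.inr (Metric.mem_closedBall_self B.rOut_pos.le)⟩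
    refine ⟨_, _, (hKs (hK.sInf_mem hne)).1, (hKs (hK.sSup_mem hne)).2, fun x hx => ?_⟩
    have hx' : x ∉ tsupport ψ ∪ tsupport η := fun h' =>
      hx ⟨csInf_le hK.bddBelow h', le_csSup hK.bddAbove h'⟩
    simp only [mem_union, not_or] at hx'
    simp [θ, image_eq_zero_of_notMem_tsupport hx'.1, image_eq_zero_of_notMem_tsupport hx'.2]
  let φ : ℝ → ℝ := fun x => ∫ t in a..x, θ t
  have hφd : ∀ x, HasDerivAt φ (θ x) x := fun x =>
    intervalIntegral.integral_hasDerivAt_right (hθ.continuous.intervalIntegrable _ _)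
      hθ.continuous.stronglyMeasurable.stronglyMeasurableAtFilter hθ.continuous.continuousAt
  have hφ' : deriv φ = θ := funext fun x => (hφd x).deriv
  have hφ : ContDiff ℝ ∞ φ :=
    contDiff_infty_iff_deriv.2 ⟨fun x => (hφd x).differentiableAt, hφ' ▸ hθ⟩
  have hφs : Function.support φ ⊆ Icc a' b' := by
    intro x hx
    by_contra hx'
    apply hx
    rw [mem_Icc, not_and_or, not_le, not_le] at hx'
    rcases hx' with hx' | hx'
    · refine (intervalIntegral.integral_congr (g := fun _ => (0 : ℝ)) fun t ht => ?_).trans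
        (by simp)
      refine hs t fun h' => ?_
      rcases le_total a x with h1 | h1
      · rw [uIcc_of_le h1] at ht
        linarith [ht.2, h'.1]
      · rw [uIcc_of_ge h1] at ht
        linarith [ht.2, h'.1]
    · refine (intervalIntegral.integral_eq_integral_of_support_subset fun t ht => ?_).trans hθ0
      by_contra ht'
      refine ht (hs t fun h' => ht' ⟨by linarith [h'.1], by linarith [h'.2]⟩)
  have hφts : tsupport φ ⊆ Icc a' b' := closure_minimal hφs isClosed_Icc
  have hφc : HasCompactSupport φ := HasCompactSupport.of_support_subset_isCompact isCompact_Icc hφs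
  have hz := hw φ hφ hφc (hφts.trans fun x hx => ⟨by linarith [hx.1], by linarith [hx.2]⟩)
  rw [hφ'] at hz
  simp only [smul_zero, integral_zero, neg_zero, θ, sub_smul, mul_smul] at hz
  rw [integral_sub (hh.continuous_smul_of_hasCompactSupport hψ.continuous hψc) 
    (Integrable.smul m (hh.continuous_smul_of_hasCompactSupport hη.continuous hηc) :
      IntegrableOn (fun x => m • η x • h x) (Ioo a b)), integral_smul, ← hcdef] at hz
  simp only [smul_sub]
  rw [integral_sub (hh.continuous_smul_of_hasCompactSupport hψ.continuous hψc) (hψi.restrict.smul_const c), integral_smul_const]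
  have hms : ∫ x in Ioo a b, ψ x = m :=
    setIntegral_eq_integral_of_forall_compl_eq_zero fun x hx =>
      image_eq_zero_of_notMem_tsupport fun h' => hx (hψs h')
  rw [hms, hz]

/-- On a bounded interval, a Sobolev function agrees a.e. with the primitive of a square integrable
function. -/
theorem MemW12.exists_isPrimitive [CompleteSpace E] {a b : ℝ} (hab : a < b) {f : ℝ → E}
    (hf : MemW12 (Ioo a b) f) :
    ∃ F g : ℝ → E, IsPrimitive F g ∧ MemLp g 2 volume ∧ (∀ x, x ∉ Ioo a b → g x = 0) ∧
      ∀ᵐ x ∂volume.restrict (Ioo a b), f x = F x := by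
  obtain ⟨hf2, g₀, hg2, hw⟩ := hf
  have hm : MeasurableSet (Ioo a b) := measurableSet_Ioo
  have hfi : IntegrableOn f (Ioo a b) := hf2.integrable (by norm_num)
  have hgi : IntegrableOn g₀ (Ioo a b) := hg2.integrable (by norm_num)
  -- Extension by zero yields a primitive on all of `ℝ`, continuous across the endpoints.
  let g := (Ioo a b).indicator g₀
  have hgl : LocallyIntegrable g := (hgi.integrable_indicator hm).locallyIntegrable
  have hF := isPrimitive_integral hgl 0 a
  set F := fun x => (0 : E) + ∫ t in a..x, g t with hFdef
  have hFi : IntegrableOn F (Ioo a b) :=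
    (hF.continuous.integrableOn_Icc).mono_set Ioo_subset_Icc_self
  have hw0 : IsWeakDeriv (Ioo a b) (fun x => f x - F x) fun _ => 0 := by
    intro φ hφ hc hU
    have h1 := hw φ hφ hc hU
    have h2 := hF.isWeakDeriv (Ioo a b) φ hφ hc hU
    have h3 : ∫ x in Ioo a b, φ x • g x = ∫ x in Ioo a b, φ x • g₀ x :=
      setIntegral_congr_fun hm fun x hx => by simp only [g, indicator_of_mem hx]
    have hcd : Continuous (deriv φ) := hφ.continuous_deriv (by simp)
    simp only [smul_sub]
    rw [integral_sub (hfi.continuous_smul_of_hasCompactSupport hcd hc.deriv) (hFi.continuous_smul_of_hasCompactSupport hcd hc.deriv), h1, h2, h3]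
    simp
  obtain ⟨c, hc⟩ := hw0.ae_eq_const hab (hfi.sub hFi)
  refine ⟨fun x => c + ∫ t in a..x, g t, g, isPrimitive_integral hgl c a,
    (memLp_indicator_iff_restrict hm).2 hg2, fun x hx => indicator_of_notMem hx _, ?_⟩
  filter_upwards [hc] with x hx
  rw [← hx, hFdef]
  simp

end Primitive

/-! ### Sorting as an isometric embedding -/

section Sorting

variable {Q : ℕ}

theorem monotone_sorted (s : Sym ℝ Q) : Monotone (sorted s) := by
  have h : (s.1.sort (· ≤ ·)).SortedLE := (Multiset.pairwise_sort s.1 (· ≤ ·)).sortedLE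
  intro i j hij
  exact h.monotone_get ((Fin.cast_le_cast _).2 hij)

theorem sorted_ofTuple {p : Fin Q → ℝ} (hp : Monotone p) : sorted (ofTuple p) = p := by
  obtain ⟨π, hπ⟩ := exists_perm_of_ofTuple_eq (ofTuple_sorted (ofTuple p))
  have h1 : sorted (ofTuple p) = p ∘ π := funext hπ
  have h2 : Monotone (p ∘ π) := h1 ▸ monotone_sorted _
  rw [h1]
  exact (Tuple.unique_monotone (f := p) (σ := π) (τ := 1) h2 hp)

theorem ξ_ofTuple {p : EuclideanSpace ℝ (Fin Q)} (hp : Monotone p) : ξ (ofTuple p) = p := by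
  ext i
  exact congrFun (sorted_ofTuple hp) i

theorem monotone_ξ (s : Sym ℝ Q) : Monotone (ξ s) := monotone_sorted s

theorem ξ_injective : Function.Injective (ξ : Sym ℝ Q → _) := fun s t h => by
  rw [← ofTuple_sorted s, ← ofTuple_sorted t]
  exact congrArg (fun p : EuclideanSpace ℝ (Fin Q) => ofTuple fun i => p i) h

theorem isClosed_setOf_monotone :
    IsClosed {p : EuclideanSpace ℝ (Fin Q) | Monotone p} := by
  simp only [Monotone, ofPred_forall]
  refine isClosed_iInter fun i => isClosed_iInter fun j => isClosed_iInter fun _ => ?_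
  exact isClosed_le (by fun_prop) (by fun_prop)

/-- The identity permutation is one competitor in the minimum. Order in `q` is not required, which
matters for tangent lines that may cross. -/
theorem dist𝒢_le_norm (s : Sym ℝ Q) (q : EuclideanSpace ℝ (Fin Q)) :
    dist𝒢 s (ofTuple q) ≤ ‖ξ s - q‖ := by
  conv_lhs => rw [← ofTuple_sorted s]
  rw [dist𝒢_ofTuple]
  refine (Finset.inf'_le _ (Finset.mem_univ 1)).trans_eq ?_
  rw [EuclideanSpace.norm_eq]
  rfl

/-- By the rearrangement inequality `ξ` is an isometric embedding. -/
theorem dist𝒢_eq_norm (s t : Sym ℝ Q) : dist𝒢 s t = ‖ξ s - ξ t‖ := by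
  apply le_antisymm
  · have := dist𝒢_le_norm s (ξ t)
    rwa [show ofTuple (ξ t) = t from ofTuple_sorted t] at this
  · refine Finset.le_inf' _ _ fun σ _ => ?_
    rw [EuclideanSpace.norm_eq]
    refine Real.sqrt_le_sqrt ?_
    -- After expanding the squares only the cross term depends on `σ`, and it is largest for the
    -- identity.
    have h := ((monotone_sorted s).monovary (monotone_sorted t)).sum_mul_comp_perm_le_sum_mul
      (σ := σ)
    have h2 : ∑ i, sorted t (σ i) ^ 2 = ∑ i, sorted t i ^ 2 :=
      Equiv.sum_comp σ fun i => sorted t i ^ 2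
    have h3 : ∀ q : Fin Q → ℝ, ∑ i, |sorted s i - q i| ^ 2 =
        ∑ i, sorted s i ^ 2 - 2 * ∑ i, sorted s i * q i + ∑ i, q i ^ 2 := by
      intro q
      rw [Finset.mul_sum, ← Finset.sum_sub_distrib, ← Finset.sum_add_distrib]
      exact Finset.sum_congr rfl fun i _ => by rw [sq_abs]; ring
    change ∑ i, |sorted s i - sorted t i| ^ 2 ≤ _
    rw [h3 (sorted t), h3 fun i => sorted t (σ i), h2]
    linarith

end Sorting

/-! ### Strict values and continuous representatives -/

section StrictlyDefined

variable {E : Type*} [NormedAddCommGroup E]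

/-- A function which agrees a.e. near `x` with a function continuous at `x` has a strict value
there. -/
theorem tendsto_lintegral_closedBall_div {f F : ℝ → E} {x : ℝ} {U : Set ℝ} (hU : U ∈ 𝓝 x)
    (hfF : ∀ᵐ z ∂volume.restrict U, f z = F z) (hF : ContinuousAt F x) :
    Tendsto (fun r : ℝ => (∫⁻ z in Metric.closedBall x r, ‖f z - F x‖ₑ) / ENNReal.ofReal r)
      (𝓝[>] 0) (𝓝 0) := by
  rw [ENNReal.tendsto_nhds_zero]
  intro ε hε
  have h2 : (0 : ℝ≥0∞) < ε / 2 := ENNReal.half_pos hε.ne'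
  have hev : ∀ᶠ z in 𝓝 x, z ∈ U ∧ ‖F z - F x‖ₑ ≤ ε / 2 := by
    refine (eventually_mem_set.2 hU).and ?_
    have h3 : Tendsto (fun z => ‖F z - F x‖ₑ) (𝓝 x) (𝓝 0) := by
      have := (hF.sub (continuousAt_const (y := F x))).enorm
      simpa [ContinuousAt] using this
    exact (ENNReal.tendsto_nhds_zero.1 h3) _ h2
  obtain ⟨δ, hδ, hball⟩ := Metric.eventually_nhds_iff_ball.1 hev
  filter_upwards [Ioo_mem_nhdsGT hδ] with r hr
  have hsub : Metric.closedBall x r ⊆ Metric.ball x δ := Metric.closedBall_subset_ball hr.2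
  have hae : ∀ᵐ z ∂volume.restrict (Metric.closedBall x r), ‖f z - F x‖ₑ ≤ ε / 2 := by
    have h4 := ae_restrict_of_ae_restrict_of_subset
      (hsub.trans fun z hz => (hball z hz).1) hfF
    filter_upwards [h4, ae_restrict_mem Metric.isClosed_closedBall.measurableSet] with z hz hz'
    rw [hz]
    exact (hball z (hsub hz')).2
  refine ENNReal.div_le_of_le_mul ((lintegral_mono_ae hae).trans_eq ?_)
  rw [setLIntegral_const, Real.volume_closedBall, ENNReal.ofReal_mul (by norm_num), ← mul_assoc]
  congr 1
  rw [ENNReal.ofReal_ofNat, ENNReal.div_mul_cancel (by simp) (by simp)]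

theorem IsStrictlyDefined.eq_of_ae_eq {U V : Set ℝ} {f F : ℝ → E} (hf : IsStrictlyDefined V f)
    {x : ℝ} (hx : x ∈ V) (hU : U ∈ 𝓝 x) (hfF : ∀ᵐ z ∂volume.restrict U, f z = F z)
    (hF : ContinuousAt F x) : f x = F x :=
  hf x hx _ (tendsto_lintegral_closedBall_div hU hfF hF)

theorem isStrictlyDefined_of_continuous {f : ℝ → E} (hf : Continuous f) (U : Set ℝ) :
    IsStrictlyDefined U f := by
  intro x _ y hy
  have h0 := tendsto_lintegral_closedBall_div (F := f) (x := x) univ_mem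
    (ae_of_all _ fun _ => rfl) hf.continuousAt
  have hsum := h0.add hy
  rw [add_zero] at hsum
  -- Integrated triangle inequality; the factor `2` is the length `2r` of the ball divided by `r`.
  have hle : ∀ᶠ r : ℝ in 𝓝[>] 0, 2 * ‖f x - y‖ₑ ≤
      (∫⁻ z in Metric.closedBall x r, ‖f z - f x‖ₑ) / ENNReal.ofReal r +
        (∫⁻ z in Metric.closedBall x r, ‖f z - y‖ₑ) / ENNReal.ofReal r := by
    filter_upwards [self_mem_nhdsWithin] with r hr
    have hr' : (0 : ℝ) < r := hr
    have hmeas : Measurable fun z => ‖f z - f x‖ₑ :=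
      (hf.sub continuous_const).enorm.measurable
    rw [← ENNReal.add_div, ← lintegral_add_left hmeas, ENNReal.le_div_iff_mul_le
      (Or.inl (by simpa using hr')) (Or.inl (by simp))]
    calc 2 * ‖f x - y‖ₑ * ENNReal.ofReal r
        = ∫⁻ _ in Metric.closedBall x r, ‖f x - y‖ₑ := by
          rw [setLIntegral_const, Real.volume_closedBall, ENNReal.ofReal_mul (by norm_num),
            ENNReal.ofReal_ofNat]
          ring
      _ ≤ _ := lintegral_mono fun z => by
          have h1 : f x - y = -(f z - f x) + (f z - y) := by abel
          rw [h1]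
          exact (enorm_add_le _ _).trans_eq (by rw [enorm_neg])
  have := ge_of_tendsto hsum hle
  have h3 : ‖f x - y‖ₑ = 0 := by simpa using this
  exact sub_eq_zero.1 (enorm_eq_zero.1 h3)

end StrictlyDefined

/-! ### Approximate affine approximation and the energy formula -/

section ApAffine

variable {Q : ℕ}

theorem affineMap_apply_eq (v : ℝ →ᵃ[ℝ] ℝ) (a x : ℝ) :
    v x = v a + v.linear 1 * (x - a) := by
  have h := v.map_vadd a (x - a)
  rw [vadd_eq_add, sub_add_cancel, vadd_eq_add] at h
  have h2 : v.linear (x - a) = (x - a) * v.linear 1 := by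
    rw [← smul_eq_mul, ← map_smul, smul_eq_mul, mul_one]
  rw [h, h2]
  ring

/-- Two functions with approximate limit `0` at `a` are simultaneously small at points arbitrarily
close to `a`. -/
theorem HasApLim.exists_lt {f g : ℝ → ℝ} {a : ℝ} (hf : HasApLim f a 0) (hg : HasApLim g a 0)
    {ε : ℝ} (hε : 0 < ε) : ∃ x, x ≠ a ∧ |x - a| ≤ ε ∧ |f x| < ε ∧ |g x| < ε := by
  -- If each bad set has relative measure below `1/4`, the two cannot cover the ball, even with the
  -- null set `{a}` added.
  have h4 : (0 : ℝ≥0∞) < 4⁻¹ := by simp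
  have h := ((hf ε hε).eventually_lt_const h4).and (((hg ε hε).eventually_lt_const h4).and
    (Ioc_mem_nhdsGT hε : ∀ᶠ r in 𝓝[>] (0 : ℝ), r ∈ Ioc 0 ε))
  obtain ⟨r, hfr, hgr, hr0, hrε⟩ := h.exists
  simp only [sub_zero] at hfr hgr
  by_contra! hcon
  set B := Metric.closedBall a r
  have hB0 : volume B ≠ 0 := by
    simp only [B, Real.volume_closedBall]
    simpa using hr0
  have hBt : volume B ≠ ⊤ := measure_closedBall_lt_top.ne
  have hsub : B ⊆ (B ∩ {x | ε ≤ |f x|}) ∪ (B ∩ {x | ε ≤ |g x|}) ∪ {a} := by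
    intro x hx
    by_cases hxa : x = a
    · exact Or.inr hxa
    by_cases hxf : ε ≤ |f x|
    · exact Or.inl (Or.inl ⟨hx, hxf⟩)
    · refine Or.inl (Or.inr ⟨hx, hcon x hxa ?_ (not_le.1 hxf)⟩)
      rw [← Real.dist_eq]
      exact (Metric.mem_closedBall.1 hx).trans hrε
  have h1 := (ENNReal.div_lt_iff (Or.inl hB0) (Or.inl hBt)).1 hfr
  have h2 := (ENNReal.div_lt_iff (Or.inl hB0) (Or.inl hBt)).1 hgr
  have hle : volume B ≤ 4⁻¹ * volume B + 4⁻¹ * volume B + 0 :=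
    (measure_mono hsub).trans <| (measure_union_le _ _).trans <| add_le_add
      ((measure_union_le _ _).trans (add_le_add h1.le h2.le)) (by simp)
  rw [add_zero, ← add_mul] at hle
  have h5 : (4⁻¹ + 4⁻¹ : ℝ≥0∞) < 1 := by
    rw [← two_mul, ← div_eq_mul_inv, ENNReal.div_lt_iff (by simp) (by simp)]
    norm_num
  have h6 : (4⁻¹ + 4⁻¹) * volume B < 1 * volume B := ENNReal.mul_lt_mul_left hB0 hBt h5
  rw [one_mul] at h6
  exact absurd hle (not_le.2 h6)

/-- The affine approximation is unique up to order. -/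
theorem HasApAffine.exists_perm {u : ℝ → Sym ℝ Q} {a : ℝ} {v w : Fin Q → (ℝ →ᵃ[ℝ] ℝ)}
    (hv : HasApAffine u a v) (hw : HasApAffine u a w) :
    ∃ σ : Equiv.Perm (Fin Q), ∀ i, (v i).linear 1 = (w (σ i)).linear 1 := by
  -- At a point where both approximations are close to `u`, the triangle inequality brings them
  -- close to each other; an optimal permutation then pairs their branches.
  have hstep : ∀ n : ℕ, ∃ (x : ℝ) (σ : Equiv.Perm (Fin Q)), x ≠ a ∧ |x - a| ≤ 1 / (n + 1 : ℝ) ∧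
      ∀ i, |v i x - w (σ i) x| ≤ 2 * (1 / (n + 1 : ℝ)) * |x - a| := by
    intro n
    obtain ⟨x, hxa, hx, h1, h2⟩ := hv.exists_lt hw (ε := 1 / (n + 1 : ℝ)) (by positivity)
    have hpos : 0 < |x - a| := abs_pos.2 (sub_ne_zero.2 hxa)
    rw [abs_div, abs_abs, div_lt_iff₀ hpos] at h1 h2
    have h3 : dist𝒢 (ofTuple fun i => v i x) (ofTuple fun i => w i x) ≤
        2 * (1 / (n + 1 : ℝ)) * |x - a| := by
      rw [dist𝒢_eq_norm] at h1 h2 ⊢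
      rw [abs_norm] at h1 h2
      rw [norm_sub_rev] at h1
      linarith [norm_sub_le_norm_sub_add_norm_sub (ξ (ofTuple fun i => v i x)) (ξ (u x))
        (ξ (ofTuple fun i => w i x))]
    rw [dist𝒢_ofTuple] at h3
    obtain ⟨σ, -, hσ⟩ := Finset.exists_mem_eq_inf' Finset.univ_nonempty
      (fun σ : Equiv.Perm (Fin Q) => √(∑ i, |v i x - w (σ i) x| ^ 2))
    refine ⟨x, σ, hxa, hx, fun i => ?_⟩
    rw [hσ] at h3
    refine le_trans (Real.le_sqrt_of_sq_le ?_) h3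
    exact Finset.single_le_sum (f := fun i => |v i x - w (σ i) x| ^ 2)
      (fun i _ => by positivity) (Finset.mem_univ i)
  choose x σ hxa hx hσ using hstep
  -- There are finitely many permutations, so one recurs along a subsequence; the limits below are
  -- taken along it.
  obtain ⟨π, hπ⟩ := Finite.exists_infinite_fiber σ
  rw [Set.infinite_coe_iff] at hπ
  have hfr : ∃ᶠ n in atTop, n ∈ σ ⁻¹' {π} := Nat.frequently_atTop_iff_infinite.2 hπ
  have : NeBot (atTop ⊓ 𝓟 (σ ⁻¹' {π})) := frequently_mem_iff_neBot.1 hfr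
  set l := atTop ⊓ 𝓟 (σ ⁻¹' {π}) with hl
  have h0 : Tendsto (fun n : ℕ => 1 / (n + 1 : ℝ)) l (𝓝 0) :=
    tendsto_one_div_add_atTop_nhds_zero_nat.mono_left inf_le_left
  have hxl : Tendsto (fun n => x n - a) l (𝓝 0) :=
    squeeze_zero_norm (fun n => by simpa using hx n) h0
  refine ⟨π, fun i => ?_⟩
  set c := v i a - w (π i) a with hc
  set m := (v i).linear 1 - (w (π i)).linear 1 with hm
  have hb : ∀ᶠ n in l, |c + m * (x n - a)| ≤ 2 * (1 / (n + 1 : ℝ)) * |x n - a| := by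
    have : ∀ᶠ n in l, n ∈ σ ⁻¹' {π} := mem_inf_of_right (mem_principal_self _)
    filter_upwards [this] with n hn
    have h := hσ n i
    rw [show σ n = π from hn, affineMap_apply_eq (v i) a, affineMap_apply_eq (w (π i)) a] at h
    convert h using 2
    rw [hc, hm]
    ring
  -- Letting `x n → a` removes the constant term; only then can the bound be divided by `|x n - a|`
  -- to remove the slope.
  have hc0 : c = 0 := by
    have h1 : Tendsto (fun n => |c + m * (x n - a)|) l (𝓝 |c + m * 0|) :=
      (tendsto_const_nhds.add (tendsto_const_nhds.mul hxl)).abs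
    have h2 : Tendsto (fun n : ℕ => 2 * (1 / (n + 1 : ℝ)) * |x n - a|) l (𝓝 (2 * 0 * |0|)) :=
      (tendsto_const_nhds.mul h0).mul hxl.abs
    have := le_of_tendsto_of_tendsto h1 h2 hb
    simpa using this
  have hm0 : |m| ≤ 2 * 0 := by
    refine ge_of_tendsto (tendsto_const_nhds.mul h0) ?_
    filter_upwards [hb] with n hn
    rw [hc0, zero_add, abs_mul] at hn
    exact le_of_mul_le_mul_right hn (abs_pos.2 (sub_ne_zero.2 (hxa n)))
  have : m = 0 := by simpa using hm0
  linarith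

/-- The affine map through `(a, c)` with slope `m`. -/
def affineLine (a c m : ℝ) : ℝ →ᵃ[ℝ] ℝ where
  toFun x := c + m * (x - a)
  linear := LinearMap.toSpanSingleton ℝ ℝ m
  map_vadd' p q := by simp; ring

theorem hasApAffine_of_hasDerivAt {u : ℝ → Sym ℝ Q} {F : ℝ → EuclideanSpace ℝ (Fin Q)}
    {d : EuclideanSpace ℝ (Fin Q)} {a : ℝ} {U : Set ℝ} (hU : U ∈ 𝓝 a)
    (hae : ∀ᵐ x ∂volume.restrict U, ξ (u x) = F x) (hF : HasDerivAt F d a) :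
    HasApAffine u a fun i => affineLine a (F a i) (d i) := by
  intro ε hε
  -- Half of `ε` gives a strict inequality off a null set, as the exceptional set is defined by `ε
  -- ≤`.
  have ho := hF.isLittleO.def (half_pos hε)
  obtain ⟨δ, hδ, hball⟩ := Metric.eventually_nhds_iff_ball.1
    ((eventually_mem_set.2 hU).and ho)
  refine tendsto_const_nhds.congr' ?_
  filter_upwards [Ioo_mem_nhdsGT hδ] with r hr
  have hsub : Metric.closedBall a r ⊆ Metric.ball a δ := Metric.closedBall_subset_ball hr.2
  have hnull : volume (Metric.closedBall a r ∩
      {x | ε ≤ |dist𝒢 (u x) (ofTuple fun i => affineLine a (F a i) (d i) x) / |x - a| - 0|})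
        = 0 := by
    have h4 := ae_restrict_of_ae_restrict_of_subset
      (hsub.trans fun z hz => (hball z hz).1) hae
    rw [inter_comm, ← Measure.restrict_apply' Metric.isClosed_closedBall.measurableSet]
    refine measure_eq_zero_iff_ae_notMem.2 ?_
    filter_upwards [h4, ae_restrict_mem Metric.isClosed_closedBall.measurableSet,
      ae_restrict_of_ae (compl_mem_ae_iff.2 (measure_singleton a))] with x hx hxB hxa
    have hpos : 0 < |x - a| := abs_pos.2 (sub_ne_zero.2 hxa)
    have h5 : dist𝒢 (u x) (ofTuple fun i => affineLine a (F a i) (d i) x) ≤ ε / 2 * |x - a| := by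
      refine (dist𝒢_le_norm (u x) (F a + (x - a) • d) |>.trans' (le_of_eq ?_)).trans ?_
      · congr 2
        funext i
        simp [affineLine, mul_comm]
      · have := (hball x (hsub hxB)).2
        rw [hx, ← sub_sub]
        simpa using this
    have h6 : 0 ≤ dist𝒢 (u x) (ofTuple fun i => affineLine a (F a i) (d i) x) := by
      rw [dist𝒢_eq_norm]
      exact norm_nonneg _
    simp only [not_le, sub_zero]
    rw [abs_of_nonneg (by positivity), div_lt_iff₀ hpos]
    nlinarith
  rw [hnull, ENNReal.zero_div]

/-- The approximation selected by choice need not be the tangent one, but its slopes agree up to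
order, so the sum of squares is the same. -/
theorem apNormSq_eq_of_hasDerivAt {u : ℝ → Sym ℝ Q} {F : ℝ → EuclideanSpace ℝ (Fin Q)}
    {d : EuclideanSpace ℝ (Fin Q)} {a : ℝ} {U : Set ℝ} (hU : U ∈ 𝓝 a)
    (hae : ∀ᵐ x ∂volume.restrict U, ξ (u x) = F x) (hF : HasDerivAt F d a) :
    apNormSq u a = ‖d‖ₑ ^ 2 := by
  have h := hasApAffine_of_hasDerivAt hU hae hF
  have hex : ∃ v, HasApAffine u a v := ⟨_, h⟩
  rw [apNormSq, dif_pos hex]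
  obtain ⟨σ, hσ⟩ := hex.choose_spec.exists_perm h
  have h1 : ∑ i, |(hex.choose i).linear 1| ^ 2 = ∑ i, |d i| ^ 2 := by
    rw [← Equiv.sum_comp σ fun i => |d i| ^ 2]
    refine Finset.sum_congr rfl fun i _ => ?_
    rw [hσ i]
    simp [affineLine]
  rw [h1, ← ofReal_norm, ← ENNReal.ofReal_pow (norm_nonneg _), EuclideanSpace.norm_sq_eq]
  simp

theorem Dir_eq_lintegral {u : ℝ → Sym ℝ Q} {F g : ℝ → EuclideanSpace ℝ (Fin Q)}
    (hF : IsPrimitive F g) {U : Set ℝ} (hU : IsOpen U)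
    (hae : ∀ᵐ x ∂volume.restrict U, ξ (u x) = F x) :
    Dir u U = ∫⁻ x in U, ‖g x‖ₑ ^ 2 := by
  refine lintegral_congr_ae ?_
  filter_upwards [ae_restrict_of_ae hF.ae_hasDerivAt, ae_restrict_mem hU.measurableSet]
    with x hx hxU
  exact apNormSq_eq_of_hasDerivAt (hU.mem_nhds hxU) hae hx

/-- Cauchy–Schwarz against the constant `1`. This is the lower bound that makes straight segments
minimizing. -/
theorem IsPrimitive.energy_ge {E : Type*} [NormedAddCommGroup E] [NormedSpace ℝ E]
    {F g : ℝ → E} (hF : IsPrimitive F g) {a b : ℝ} (hab : a < b) :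
    ENNReal.ofReal (‖F b - F a‖ ^ 2 / (b - a)) ≤ ∫⁻ x in Ioo a b, ‖g x‖ₑ ^ 2 := by
  have hba : 0 < b - a := sub_pos.2 hab
  have hm : AEStronglyMeasurable g (volume.restrict (Ioo a b)) :=
    hF.1.aestronglyMeasurable.restrict
  have h1 : ‖F b - F a‖ₑ ≤ ∫⁻ x in Ioo a b, ‖g x‖ₑ := by
    rw [hF.2, intervalIntegral.integral_of_le hab.le, integral_Ioc_eq_integral_Ioo]
    exact enorm_integral_le_lintegral_enorm _
  have h2 := ENNReal.lintegral_mul_le_Lp_mul_Lq (volume.restrict (Ioo a b))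
    Real.HolderConjugate.two_two hm.enorm (g := fun _ => 1) aemeasurable_const
  have h3 := h1.trans ((le_of_eq (by simp)).trans h2)
  have h4 : ‖F b - F a‖ₑ ^ 2 ≤ (∫⁻ x in Ioo a b, ‖g x‖ₑ ^ 2) * ENNReal.ofReal (b - a) := by
    refine (pow_le_pow_left' h3 2).trans_eq ?_
    rw [mul_pow, ← ENNReal.rpow_natCast, ← ENNReal.rpow_natCast, ← ENNReal.rpow_mul,
      ← ENNReal.rpow_mul]
    simp
  rw [ENNReal.ofReal_div_of_pos hba]
  refine ENNReal.div_le_of_le_mul ?_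
  rwa [ENNReal.ofReal_pow (norm_nonneg _), ofReal_norm]

end ApAffine

/-! ### Boundary values and minimizers -/

section BoundaryValues

theorem MemW12.mono {E : Type*} [NormedAddCommGroup E] [NormedSpace ℝ E] {U V : Set ℝ}
    (hUV : U ⊆ V) {f : ℝ → E} (hf : MemW12 V f) : MemW12 U f := by
  obtain ⟨h2, g, hg, hw⟩ := hf
  refine ⟨h2.mono_measure (Measure.restrict_mono hUV le_rfl), g,
    hg.mono_measure (Measure.restrict_mono hUV le_rfl), fun φ hφ hc hs => ?_⟩
  have h := hw φ hφ hc (hs.trans hUV)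
  have hd := Subset.trans (tsupport_deriv_subset (𝕜 := ℝ) (f := φ)) hs
  rwa [setIntegral_smul_of_tsupport_subset (hs.trans hUV),
    setIntegral_smul_of_tsupport_subset (hd.trans hUV),
    ← setIntegral_smul_of_tsupport_subset hs, ← setIntegral_smul_of_tsupport_subset hd] at h

variable {Q : ℕ} {a b : ℝ} {u : ℝ → Sym ℝ Q} {F g : ℝ → EuclideanSpace ℝ (Fin Q)}

theorem IsPrimitive.memY2 (hF : IsPrimitive F g) (hg : MemLp g 2 (volume.restrict (Ioo a b)))
    (hae : ∀ᵐ x ∂volume.restrict (Ioo a b), ξ (u x) = F x) : MemY2 (Ioo a b) u := by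
  have hF2 : MemLp F 2 (volume.restrict (Ioo a b)) := by
    obtain ⟨C, hC⟩ := isCompact_Icc.exists_bound_of_continuousOn
      (hF.continuous.continuousOn (s := Icc a b))
    refine MemLp.of_bound hF.continuous.aestronglyMeasurable C ?_
    filter_upwards [ae_restrict_mem measurableSet_Ioo] with x hx
    exact hC x (Ioo_subset_Icc_self hx)
  refine ⟨(memLp_congr_ae hae).2 hF2, g, hg, fun φ hφ hc hs => ?_⟩
  rw [← hF.isWeakDeriv (Ioo a b) φ hφ hc hs]
  refine integral_congr_ae ?_
  filter_upwards [hae] with x hx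
  rw [hx]

/-- The set where `F` leaves the closed cone is open, and it is null in the interval, hence empty
there; the closure supplies the endpoints. -/
theorem monotone_of_ae_eq_ξ (hab : a < b) (hF : Continuous F)
    (hae : ∀ᵐ x ∂volume.restrict (Ioo a b), ξ (u x) = F x) {x : ℝ} (hx : x ∈ Icc a b) :
    Monotone (F x) := by
  let S := F ⁻¹' {p : EuclideanSpace ℝ (Fin Q) | Monotone p}
  have hS : IsClosed S := isClosed_setOf_monotone.preimage hF
  have hsub : Ioo a b ⊆ S := by
    have h0 : volume (Ioo a b ∩ Sᶜ) = 0 := by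
      rw [inter_comm, ← Measure.restrict_apply' measurableSet_Ioo]
      refine measure_eq_zero_iff_ae_notMem.2 ?_
      filter_upwards [hae] with x hx
      refine not_not.2 ?_
      change Monotone (F x)
      rw [← hx]
      exact monotone_ξ _
    rw [(isOpen_Ioo.inter hS.isOpen_compl).measure_eq_zero_iff volume] at h0
    intro x hx
    by_contra hxS
    exact (h0 ▸ (⟨hx, hxS⟩ : x ∈ Ioo a b ∩ Sᶜ) : x ∈ (∅ : Set ℝ))
  have := closure_minimal hsub hS
  rw [closure_Ioo hab.ne] at this
  exact this hx

/-- The boundary values of a Sobolev map are those of its continuous representative. -/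
theorem HasBoundaryValues.ξ_eq (hab : a < b) (hF : Continuous F)
    (hae : ∀ᵐ x ∂volume.restrict (Ioo a b), ξ (u x) = F x) {h : ℝ → Sym ℝ Q}
    (hb : HasBoundaryValues (Ioo a b) u h) : ξ (h a) = F a ∧ ξ (h b) = F b := by
  obtain ⟨w, hw, hs, hwu, hwh⟩ := hb
  -- On the enlarged interval `a` and `b` are interior, so strict definedness fixes the values of
  -- `w` there.
  obtain ⟨G, k, hG, -, -, hGw⟩ := (MemW12.mono (subset_univ (Ioo (a - 1) (b + 1)))
    hw).exists_isPrimitive (by linarith)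
  have hwG : ∀ x ∈ Ioo (a - 1) (b + 1), ξ (w x) = G x := fun x hx =>
    IsStrictlyDefined.eq_of_ae_eq hs (mem_univ x) (isOpen_Ioo.mem_nhds hx) hGw
      hG.continuous.continuousAt
  have hGF : EqOn G F (Icc a b) := by
    refine Measure.eqOn_Icc_of_ae_eq volume hab.ne ?_ hG.continuous.continuousOn hF.continuousOn
    rw [← restrict_Ioo_eq_restrict_Icc]
    filter_upwards [hae, hwu, ae_restrict_mem measurableSet_Ioo] with x h1 h2 hx
    rw [← h1, ← h2, hwG x ⟨by linarith [hx.1], by linarith [hx.2]⟩]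
  rw [frontier_Ioo hab] at hwh
  rw [← hwh a (by simp), ← hwh b (by simp), hwG a ⟨by linarith, by linarith⟩,
    hwG b ⟨by linarith, by linarith⟩]
  exact ⟨hGF (left_mem_Icc.2 hab.le), hGF (right_mem_Icc.2 hab.le)⟩

theorem monotone_smul {p : EuclideanSpace ℝ (Fin Q)} (hp : Monotone p) {c : ℝ} (hc : 0 ≤ c) :
    Monotone (c • p) := fun i j hij => by
  simpa using mul_le_mul_of_nonneg_left (hp hij) hc

/-- A continuous Sobolev map on `[a, b]` extends to a strictly defined map in `𝒴₂(ℝ, 𝐐_Q(ℝ))`,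
interpolating linearly to `0` on both sides. -/
theorem exists_extension (hab : a < b) (hF : IsPrimitive F g)
    (hg : MemLp g 2 (volume.restrict (Ioo a b))) (hmono : ∀ x ∈ Icc a b, Monotone (F x)) :
    ∃ w : ℝ → Sym ℝ Q, MemY2 univ w ∧ StrictlyDefined univ w ∧
      ∀ x ∈ Icc a b, ξ (w x) = F x := by
  -- The derivative of the extension: slopes `F a` and `-F b` on the unit intervals to either side
  -- join `0` to the endpoint values. These ramps are nonnegative multiples of monotone vectors, so
  -- they stay in the cone.
  let k : ℝ → EuclideanSpace ℝ (Fin Q) := fun t =>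
    (Ioc (a - 1) a).indicator (fun _ => F a) t + (Ioc a b).indicator g t -
      (Ioc b (b + 1)).indicator (fun _ => F b) t
  have hk2 : MemLp k 2 volume := by
    have h1 := memLp_indicator_const 2 (measurableSet_Ioc (a := a - 1) (b := a)) (F a)
      (μ := volume) (Or.inr (by simp))
    have h2 := memLp_indicator_const 2 (measurableSet_Ioc (a := b) (b := b + 1)) (F b)
      (μ := volume) (Or.inr (by simp))
    have h3 : MemLp ((Ioc a b).indicator g) 2 volume := by
      rw [memLp_indicator_iff_restrict measurableSet_Ioc, ← restrict_Ioo_eq_restrict_Ioc]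
      exact hg
    exact (h1.add h3).sub h2
  have hkl : LocallyIntegrable k := hk2.locallyIntegrable (by norm_num)
  have hG := isPrimitive_integral hkl 0 (a - 1)
  set G : ℝ → EuclideanSpace ℝ (Fin Q) := fun x => 0 + ∫ t in (a - 1)..x, k t with hGdef
  have hinc : ∀ {x y : ℝ}, x ≤ y → ∀ f : ℝ → EuclideanSpace ℝ (Fin Q),
      (∀ t ∈ Ioc x y, k t = f t) → G y = G x + ∫ t in x..y, f t := by
    intro x y hxy f hf
    rw [← intervalIntegral.integral_congr_ae (f := k), ← hG.2]
    · abel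
    · rw [uIoc_of_le hxy]
      exact ae_of_all _ hf
  have G0 : G (a - 1) = 0 := by simp [hGdef]
  have G1 : ∀ x ≤ a - 1, G x = 0 := by
    intro x hx
    have := hinc hx (fun _ => 0) fun t ht => by
      simp only [k]
      rw [indicator_of_notMem, indicator_of_notMem, indicator_of_notMem] <;>
        simp only [mem_Ioc, not_and_or, not_lt, not_le, add_zero, sub_zero] <;> left <;>
        linarith [ht.1, ht.2]
    simpa [G0] using this.symm
  have G2 : ∀ x ∈ Icc (a - 1) a, G x = (x - (a - 1)) • F a := by
    intro x hx
    have := hinc hx.1 (fun _ => F a) fun t ht => by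
      have htm : t ∈ Ioc (a - 1) a := ⟨ht.1, ht.2.trans hx.2⟩
      simp only [k]
      rw [indicator_of_mem htm, indicator_of_notMem,
        indicator_of_notMem, add_zero, sub_zero] <;>
        simp only [mem_Ioc, not_and_or, not_lt, not_le] <;> left <;>
        linarith [ht.1, ht.2, hx.2]
    rw [this, G0, intervalIntegral.integral_const, zero_add]
  have Ga : G a = F a := by
    rw [G2 a ⟨by linarith, le_rfl⟩]
    simp
  have G3 : ∀ x ∈ Icc a b, G x = F x := by
    intro x hx
    have := hinc hx.1 g fun t ht => by
      have htm : t ∈ Ioc a b := ⟨ht.1, ht.2.trans hx.2⟩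
      simp only [k]
      rw [indicator_of_mem htm, indicator_of_notMem,
        indicator_of_notMem, zero_add, sub_zero] <;>
        simp only [mem_Ioc, not_and_or, not_lt, not_le]
      · left; linarith [ht.2, hx.2]
      · right; linarith [ht.1]
    rw [this, Ga, ← hF.2]
    abel
  have Gb : G b = F b := G3 b (right_mem_Icc.2 hab.le)
  have G4 : ∀ x ∈ Icc b (b + 1), G x = (b + 1 - x) • F b := by
    intro x hx
    have := hinc hx.1 (fun _ => -F b) fun t ht => by
      have htm : t ∈ Ioc b (b + 1) := ⟨ht.1, ht.2.trans hx.2⟩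
      simp only [k]
      rw [indicator_of_mem htm, indicator_of_notMem,
        indicator_of_notMem, zero_add, zero_sub] <;>
        simp only [mem_Ioc, not_and_or, not_lt, not_le] <;> right <;> linarith [ht.1]
    rw [this, Gb, intervalIntegral.integral_const]
    module
  have G5 : ∀ x, b + 1 ≤ x → G x = 0 := by
    intro x hx
    have := hinc hx (fun _ => 0) fun t ht => by
      simp only [k]
      rw [indicator_of_notMem, indicator_of_notMem, indicator_of_notMem] <;>
        simp only [mem_Ioc, not_and_or, not_lt, not_le, add_zero, sub_zero] <;> right <;>
        linarith [ht.1, ht.2]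
    rw [this, G4 (b + 1) ⟨by linarith, le_rfl⟩]
    simp
  have hGm : ∀ x, Monotone (G x) := by
    have h0 : Monotone (0 : EuclideanSpace ℝ (Fin Q)) := fun _ _ _ => le_rfl
    intro x
    rcases le_total x (a - 1) with h1 | h1
    · rwa [G1 x h1]
    rcases le_total x a with h2 | h2
    · rw [G2 x ⟨h1, h2⟩]
      exact monotone_smul (hmono a (left_mem_Icc.2 hab.le)) (by linarith)
    rcases le_total x b with h3 | h3
    · rw [G3 x ⟨h2, h3⟩]
      exact hmono x ⟨h2, h3⟩
    rcases le_total x (b + 1) with h4 | h4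
    · rw [G4 x ⟨h3, h4⟩]
      exact monotone_smul (hmono b (right_mem_Icc.2 hab.le)) (by linarith)
    · rwa [G5 x h4]
  have hξ : (fun x => ξ (ofTuple (G x))) = G := funext fun x => ξ_ofTuple (hGm x)
  have hGc : HasCompactSupport G := by
    refine HasCompactSupport.of_support_subset_isCompact (isCompact_Icc (a := a - 1) (b := b + 1))
      fun x hx => ?_
    by_contra hx'
    rw [mem_Icc, not_and_or, not_le, not_le] at hx'
    exact hx (hx'.elim (fun h => G1 x h.le) fun h => G5 x h.le)
  refine ⟨fun x => ofTuple (G x), ?_, ?_, fun x hx => ?_⟩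
  · rw [MemY2, hξ]
    exact ⟨(hG.continuous.memLp_of_hasCompactSupport hGc).restrict _, k, hk2.restrict _,
      hG.isWeakDeriv _⟩
  · rw [StrictlyDefined, hξ]
    exact isStrictlyDefined_of_continuous hG.continuous _
  · rw [ξ_ofTuple (hGm x), G3 x hx]

theorem hasBoundaryValues_iff (hab : a < b) (hF : IsPrimitive F g)
    (hg : MemLp g 2 (volume.restrict (Ioo a b)))
    (hae : ∀ᵐ x ∂volume.restrict (Ioo a b), ξ (u x) = F x) {h : ℝ → Sym ℝ Q} :
    HasBoundaryValues (Ioo a b) u h ↔ ξ (h a) = F a ∧ ξ (h b) = F b := by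
  refine ⟨HasBoundaryValues.ξ_eq hab hF.continuous hae, fun hh => ?_⟩
  obtain ⟨w, hw, hs, hwF⟩ := exists_extension hab hF hg
    fun x hx => monotone_of_ae_eq_ξ hab hF.continuous hae hx
  refine ⟨w, hw, hs, ?_, ?_⟩
  · filter_upwards [hae, ae_restrict_mem measurableSet_Ioo] with x hx hx'
    exact ξ_injective (by rw [hx, hwF x (Ioo_subset_Icc_self hx')])
  · rw [frontier_Ioo hab]
    rintro x (rfl | rfl)
    · exact ξ_injective (by rw [hh.1, hwF _ (left_mem_Icc.2 hab.le)])
    · exact ξ_injective (by rw [hh.2, hwF _ (right_mem_Icc.2 hab.le)])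

theorem HasBoundaryValues.le_Dir (hab : a < b) {w h : ℝ → Sym ℝ Q} (hw : MemY2 (Ioo a b) w)
    (hb : HasBoundaryValues (Ioo a b) w h) :
    ENNReal.ofReal (dist𝒢 (h b) (h a) ^ 2 / (b - a)) ≤ Dir w (Ioo a b) := by
  obtain ⟨F, g, hF, -, -, hae⟩ := MemW12.exists_isPrimitive hab hw
  obtain ⟨h1, h2⟩ := hb.ξ_eq hab hF.continuous hae
  rw [dist𝒢_eq_norm, h1, h2, Dir_eq_lintegral hF isOpen_Ioo hae]
  exact hF.energy_ge hab

/-- Linear interpolation of the sorted boundary values is Dirichlet minimizing. -/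
theorem exists_isDirMinimizing (hab : a < b) (h : ℝ → Sym ℝ Q) :
    ∃ v, IsDirMinimizing (Ioo a b) h v ∧
      Dir v (Ioo a b) = ENNReal.ofReal (dist𝒢 (h b) (h a) ^ 2 / (b - a)) := by
  have hba : 0 < b - a := sub_pos.2 hab
  let m : EuclideanSpace ℝ (Fin Q) := (b - a)⁻¹ • (ξ (h b) - ξ (h a))
  have hF := isPrimitive_integral (g := fun _ => m) continuous_const.locallyIntegrable (ξ (h a)) a
  set F : ℝ → EuclideanSpace ℝ (Fin Q) := fun x => ξ (h a) + ∫ _ in a..x, m with hFdef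
  have hFx : ∀ x, F x = ξ (h a) + (x - a) • m := fun x => by
    rw [hFdef]
    simp only [intervalIntegral.integral_const]
  have hFa : F a = ξ (h a) := by simp [hFx]
  have hFb : F b = ξ (h b) := by
    rw [hFx]
    simp only [m]
    rw [smul_inv_smul₀ hba.ne']
    abel
  have hFm : ∀ x ∈ Icc a b, Monotone (F x) := by
    intro x hx i j hij
    have h1 := monotone_ξ (h a) hij
    have h2 := monotone_ξ (h b) hij
    -- Written as a convex combination of the two sorted endpoints, so monotonicity is inherited.
    have key : ∀ l, F x l = (b - a)⁻¹ * ((b - x) * ξ (h a) l + (x - a) * ξ (h b) l) := by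
      intro l
      rw [hFx]
      simp only [m, PiLp.add_apply, PiLp.smul_apply, PiLp.sub_apply, smul_eq_mul]
      field_simp
      ring
    rw [key, key]
    refine mul_le_mul_of_nonneg_left (add_le_add ?_ ?_) (by positivity)
    · exact mul_le_mul_of_nonneg_left h1 (by linarith [hx.2])
    · exact mul_le_mul_of_nonneg_left h2 (by linarith [hx.1])
  let v : ℝ → Sym ℝ Q := fun x => ofTuple (F x)
  have hae : ∀ᵐ x ∂volume.restrict (Ioo a b), ξ (v x) = F x := by
    filter_upwards [ae_restrict_mem measurableSet_Ioo] with x hx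
    exact ξ_ofTuple (hFm x (Ioo_subset_Icc_self hx))
  have hg : MemLp (fun _ : ℝ => m) 2 (volume.restrict (Ioo a b)) := memLp_const m
  have hD : Dir v (Ioo a b) = ENNReal.ofReal (dist𝒢 (h b) (h a) ^ 2 / (b - a)) := by
    rw [Dir_eq_lintegral hF isOpen_Ioo hae, setLIntegral_const, Real.volume_Ioo, dist𝒢_eq_norm,
      ← ofReal_norm, ← ENNReal.ofReal_pow (norm_nonneg _), ← ENNReal.ofReal_mul (by positivity)]
    congr 1
    simp only [m, norm_smul, norm_inv, Real.norm_eq_abs, abs_of_pos hba]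
    field_simp
  have hv := hF.memY2 hg hae
  have hbv := (hasBoundaryValues_iff hab hF hg hae).2 ⟨hFa.symm, hFb.symm⟩
  refine ⟨v, ⟨hv, hbv, le_antisymm (le_sInf ?_) (sInf_le ⟨v, hv, hbv, rfl⟩)⟩, hD⟩
  rintro _ ⟨w, hw, hwb, rfl⟩
  rw [hD]
  exact hwb.le_Dir hab hw

end BoundaryValues

end MultiValued

end

/-! ### The equivalence -/

open MultiValued in
theorem mainTheorem7 (Q : ℕ) (hQ : 0 < Q) (K : ℝ) (hK : 1 < K) (u : ℝ → Sym ℝ Q)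
    (hu : MemY2 (Ioo (-1) 1) u) (hs : StrictlyDefined (Ioo (-1) 1) u) :
    List.TFAE [
      IsQuasiminimizer K u,
      ∀ a b : ℝ, -1 < a → a < b → b < 1 →
        Dir u (Ioo a b) ≤ ENNReal.ofReal (K * (dist𝒢 (u b) (u a) ^ 2 / (b - a))),
      ∀ a b : ℝ, -1 ≤ a → a < b → b ≤ 1 →
        ∃ g : ℝ → Sym ℝ Q, HasBoundaryValues (Ioo a b) u g ∧
          Dir u (Ioo a b) ≤ ENNReal.ofReal (K * (dist𝒢 (g b) (g a) ^ 2 / (b - a)))] := by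
  have hK0 : 0 ≤ K := by linarith
  obtain ⟨F, g, hF, hg, -, hae⟩ := MemW12.exists_isPrimitive (by norm_num) hu
  have huF : ∀ x ∈ Ioo (-1 : ℝ) 1, ξ (u x) = F x := fun x hx =>
    IsStrictlyDefined.eq_of_ae_eq hs hx (isOpen_Ioo.mem_nhds hx) hae hF.continuous.continuousAt
  have hsub : ∀ {a b : ℝ}, -1 ≤ a → b ≤ 1 →
      ∀ᵐ x ∂volume.restrict (Ioo a b), ξ (u x) = F x := fun ha hb =>
    ae_restrict_of_ae_restrict_of_subset (Ioo_subset_Ioo ha hb) hae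
  have hbv : ∀ {a b : ℝ} {h : ℝ → Sym ℝ Q}, -1 ≤ a → a < b → b ≤ 1 →
      (HasBoundaryValues (Ioo a b) u h ↔ ξ (h a) = F a ∧ ξ (h b) = F b) := fun ha hab hb =>
    hasBoundaryValues_iff hab hF (hg.restrict _) (hsub ha hb)
  tfae_have 1 → 2 := by
    rintro ⟨-, -, hq⟩ a b ha hab hb
    obtain ⟨v, hv, hD⟩ := exists_isDirMinimizing hab u
    have hbu := (hbv ha.le hab hb.le).2 ⟨huF a ⟨ha, by linarith⟩, huF b ⟨by linarith, hb⟩⟩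
    rw [ENNReal.ofReal_mul hK0, ← hD]
    exact hq a b ha.le hab hb.le u v hbu hv
  tfae_have 2 → 3 := by
    intro h2 a b ha hab hb
    have hξ : ∀ x ∈ Icc (-1 : ℝ) 1, ξ (ofTuple (F x)) = F x := fun x hx =>
      ξ_ofTuple (monotone_of_ae_eq_ξ (by norm_num) hF.continuous hae hx)
    have hFa := hξ a ⟨ha, by linarith⟩
    have hFb := hξ b ⟨by linarith, hb⟩
    -- Strict definedness says nothing about `u` at `±1`, so the boundary values come from the
    -- continuous representative.
    refine ⟨fun x => ofTuple (F x), (hbv ha hab hb).2 ⟨hFa, hFb⟩, ?_⟩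
    have hgi : Integrable fun x => ‖g x‖ ^ 2 := hg.integrable_norm_pow (by norm_num)
    -- The energy becomes an increment of a continuous function, so both sides of the inequality
    -- pass to the limit as the endpoints are approached from inside.
    have hH := isPrimitive_integral hgi.locallyIntegrable 0 0
    set H : ℝ → ℝ := fun x => 0 + ∫ t in 0..x, ‖g t‖ ^ 2
    have hDir : ∀ {x y : ℝ}, -1 ≤ x → x < y → y ≤ 1 →
        Dir u (Ioo x y) = ENNReal.ofReal (H y - H x) := by
      intro x y hx hxy hy
      rw [Dir_eq_lintegral hF isOpen_Ioo (hsub hx hy), hH.2,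
        intervalIntegral.integral_of_le hxy.le, integral_Ioc_eq_integral_Ioo,
        ofReal_integral_eq_lintegral_ofReal hgi.restrict (ae_of_all _ fun t => by positivity)]
      refine lintegral_congr fun t => ?_
      rw [ENNReal.ofReal_pow (norm_nonneg _), ofReal_norm]
    have hineq : ∀ x y : ℝ, -1 < x → x < y → y < 1 →
        H y - H x ≤ K * (‖F y - F x‖ ^ 2 / (y - x)) := by
      intro x y hx hxy hy
      have hxy' : 0 < y - x := sub_pos.2 hxy
      have h := h2 x y hx hxy hy
      rw [hDir hx.le hxy hy.le, dist𝒢_eq_norm, huF x ⟨hx, by linarith⟩,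
        huF y ⟨by linarith, hy⟩] at h
      exact (ENNReal.ofReal_le_ofReal_iff (by positivity)).1 h
    rw [hDir ha hab hb, dist𝒢_eq_norm, hFa, hFb]
    refine ENNReal.ofReal_le_ofReal ?_
    have tx : Tendsto Prod.fst (𝓝[>] a ×ˢ 𝓝[<] b) (𝓝 a) :=
      tendsto_fst.mono_right nhdsWithin_le_nhds
    have ty : Tendsto Prod.snd (𝓝[>] a ×ˢ 𝓝[<] b) (𝓝 b) :=
      tendsto_snd.mono_right nhdsWithin_le_nhds
    have hev : ∀ᶠ p in 𝓝[>] a ×ˢ 𝓝[<] b,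
        H p.2 - H p.1 ≤ K * (‖F p.2 - F p.1‖ ^ 2 / (p.2 - p.1)) := by
      have hc1 : a < (a + b) / 2 := by linarith
      have hc2 : (a + b) / 2 < b := by linarith
      filter_upwards [prod_mem_prod (Ioo_mem_nhdsGT hc1) (Ioo_mem_nhdsLT hc2)] with p hp
      obtain ⟨⟨h1, h3⟩, h4, h5⟩ := hp
      exact hineq _ _ (by linarith) (by linarith) (by linarith)
    refine le_of_tendsto_of_tendsto ?_ ?_ hev
    · exact ((hH.continuous.tendsto b).comp ty).sub ((hH.continuous.tendsto a).comp tx)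
    · exact (((((hF.continuous.tendsto b).comp ty).sub
        ((hF.continuous.tendsto a).comp tx)).norm.pow 2).div (ty.sub tx)
          (sub_pos.2 hab).ne').const_mul K
  tfae_have 3 → 1 := by
    intro h3
    refine ⟨hu, hs, fun a b ha hab hb h v hbu hv => ?_⟩
    obtain ⟨k, hk, hD⟩ := h3 a b ha hab hb
    obtain ⟨hka, hkb⟩ := (hbv ha hab hb).1 hk
    obtain ⟨hha, hhb⟩ := (hbv ha hab hb).1 hbu
    refine hD.trans ?_
    -- Boundary values are unique, so the `k` supplied by 3 and the prescribed `h` agree at both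
    -- endpoints.
    rw [ENNReal.ofReal_mul hK0, dist𝒢_eq_norm, hka, hkb, ← hha, ← hhb, ← dist𝒢_eq_norm]
    gcongr
    exact hv.2.1.le_Dir hab hv.1
  tfae_finish
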